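/- Let $D$ be a simple unital exact C*-algebra with a unique tracial state $\sigma$, let $X$ be an infinite compact metric space, and let $h \colon X \to X$ be a minimal homeomorphism. Let $x \mapsto \alpha_x$ be a function from $X$ to $\operatorname{Aut}(D)$ such that $x \mapsto \alpha_x(d)$ is continuous for every $d \in D$, and let $\alpha \in \operatorname{Aut}(C(X,D))$ be the automorphism given by $\alpha(a)(x) = \alpha_x(a(h^{-1}(x)))$. Let $C^*(\mathbb{Z}, C(X,D), \alpha)$ be the crossed product, with canonical unitary $u$, and let $E \colon C^*(\mathbb{Z}, C(X,D), \alpha) \to C(X,D)$ be the standard conditional expectation, that is, the unique continuous linear map with $E(f) = f$ and $E(f u^n) = 0$ for all $f \in C(X,D)$ and $n \in \mathbb{Z} \setminus \{0\}$. For an $h$-invariant Borel probability measure $\mu$ on $X$, define \[ \tau_\mu(a) = \int_X \sigma(E(a)(x)) \, d\mu(x) \qquad (a \in C^*(\mathbb{Z}, C(X,D), \alpha)). \] Then $E$ exists, $\tau_\mu$ is always a tracial state, and $\mu \mapsto \tau_\mu$ is an affine bijective homeomorphism from the space $M_h(X)$ of $h$-invariant Borel probability measures on $X$ to the space of tracial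 states on $C^*(\mathbb{Z}, C(X,D), \alpha)$, both with their weak-* topologies. -/

import Mathlib

open Set Topology MeasureTheory
open scoped ENNReal NNReal TensorProduct ComplexOrder

/-! ### Simple and exact C*-algebras -/

/-- A C*-algebra is simple if it is nonzero and its only closed two-sided ideals are the
trivial ones. -/
def IsSimpleCStarAlgebra (D : Type*) [CStarAlgebra D] : Prop :=
  Nontrivial D ∧ ∀ I : TwoSidedIdeal D, IsClosed (I : Set D) → I = ⊥ ∨ I = ⊤

/-- For representations `π` of `B` on `H` and `ρ` of `D` on `K`, the representation `π ⊗ ρ` of the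
algebraic tensor product `B ⊗ D` on the algebraic tensor product `H ⊗ K`
(a dense subspace of the Hilbert space tensor product). -/
noncomputable def tensorRep {B D H K : Type*} [NonUnitalCStarAlgebra B] [NonUnitalCStarAlgebra D]
    [NormedAddCommGroup H] [InnerProductSpace ℂ H] [CompleteSpace H]
    [NormedAddCommGroup K] [InnerProductSpace ℂ K] [CompleteSpace K]
    (π : B →⋆ₙₐ[ℂ] (H →L[ℂ] H)) (ρ : D →⋆ₙₐ[ℂ] (K →L[ℂ] K)) :
    B ⊗[ℂ] D →ₗ[ℂ] (H ⊗[ℂ] K →ₗ[ℂ] H ⊗[ℂ] K) :=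
  TensorProduct.homTensorHomMap (RingHom.id ℂ) H K H K ∘ₗ
    TensorProduct.map (ContinuousLinearMap.coeLM ℂ ∘ₗ (π : B →ₗ[ℂ] (H →L[ℂ] H)))
      (ContinuousLinearMap.coeLM ℂ ∘ₗ (ρ : D →ₗ[ℂ] (K →L[ℂ] K)))

/-- The minimal (spatial) C*-norm of `t`, that is, the supremum of `‖(π ⊗ ρ) t‖` over all pairs of
Hilbert space representations, is at most `r`. -/
def MinTensorNormLE.{u, v} {B : Type u} {D : Type v} [NonUnitalCStarAlgebra B]
    [NonUnitalCStarAlgebra D] (t : B ⊗[ℂ] D) (r : ℝ) : Prop :=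
  ∀ (H : Type u) [NormedAddCommGroup H] [InnerProductSpace ℂ H] [CompleteSpace H]
    (K : Type v) [NormedAddCommGroup K] [InnerProductSpace ℂ K] [CompleteSpace K]
    (π : B →⋆ₙₐ[ℂ] (H →L[ℂ] H)) (ρ : D →⋆ₙₐ[ℂ] (K →L[ℂ] K)) (ξ : H ⊗[ℂ] K),
    ‖tensorRep π ρ t ξ‖ ≤ r * ‖ξ‖

/-- `D` is exact: for every short exact sequence `0 → J → B → C → 0` of C*-algebras, the sequence
`0 → J ⊗ D → B ⊗ D → C ⊗ D → 0` of minimal tensor products is exact. Only exactness in the middle is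
not automatic. It says that the kernel of `B ⊗ D → C ⊗ D` is the closure of the algebraic
tensor product of `J = ker q` and `D`; the elements of the completed tensor product `B ⊗ D` are
represented by Cauchy sequences in the algebraic one. -/
def IsExactCStarAlgebra.{u} (D : Type u) [NonUnitalCStarAlgebra D] : Prop :=
  ∀ (B C : Type u) [NonUnitalCStarAlgebra B] [NonUnitalCStarAlgebra C] (q : B →⋆ₙₐ[ℂ] C),
    Function.Surjective q →
    ∀ t : ℕ → B ⊗[ℂ] D,
      (∀ ε > 0, ∃ N, ∀ m ≥ N, ∀ n ≥ N, MinTensorNormLE (t m - t n) ε) →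
      (∀ ε > 0, ∃ N, ∀ n ≥ N,
        MinTensorNormLE (TensorProduct.map (q : B →ₗ[ℂ] C) LinearMap.id (t n)) ε) →
      ∃ s : ℕ → B ⊗[ℂ] D,
        (∀ n, s n ∈ Submodule.span ℂ {z | ∃ (b : B) (d : D), q b = 0 ∧ z = b ⊗ₜ[ℂ] d}) ∧
        ∀ ε > 0, ∃ N, ∀ n ≥ N, MinTensorNormLE (t n - s n) ε

/-! ### Tracial states and invariant measures -/

/-- The tracial states of a unital C*-algebra, with the weak-* topology. -/
def tracialStates (A : Type*) [CStarAlgebra A] : Set (WeakDual ℂ A) :=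
  {τ | (∀ a, 0 ≤ τ (star a * a)) ∧ τ 1 = 1 ∧ ∀ a b, τ (a * b) = τ (b * a)}

/-- The `h`-invariant Borel probability measures, with the topology of weak convergence. -/
def invariantMeasures {X : Type*} [TopologicalSpace X] [MeasurableSpace X] [BorelSpace X]
    (h : X ≃ₜ X) : Set (ProbabilityMeasure X) :=
  {μ | (μ : Measure X).map h = μ}

/-- A homeomorphism is minimal if it has no nontrivial invariant closed subset. -/
def IsMinimalHomeomorph {X : Type*} [TopologicalSpace X] (h : X ≃ₜ X) : Prop :=
  ∀ K : Set X, IsClosed K → h '' K = K → K = ∅ ∨ K = univ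

/-! ### The automorphism of `C(X, D)` over a homeomorphism -/

theorem continuous_family_apply {X D : Type*} [TopologicalSpace X] [CStarAlgebra D]
    (β : X → D ≃⋆ₐ[ℂ] D) (hβ : ∀ d, Continuous fun x => β x d) (f : X → D) (hf : Continuous f) :
    Continuous fun x => β x (f x) := by
  rw [continuous_iff_continuousAt]
  intro x
  rw [ContinuousAt, tendsto_iff_norm_sub_tendsto_zero]
  have h1 : Filter.Tendsto (fun y => ‖f y - f x‖ + ‖β y (f x) - β x (f x)‖) (𝓝 x) (𝓝 (0 + 0)) :=
    (tendsto_iff_norm_sub_tendsto_zero.1 hf.continuousAt).add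
      (tendsto_iff_norm_sub_tendsto_zero.1 (hβ (f x)).continuousAt)
  rw [add_zero] at h1
  refine squeeze_zero (fun _ => norm_nonneg _) (fun y => ?_) h1
  calc ‖β y (f y) - β x (f x)‖ = ‖β y (f y - f x) + (β y (f x) - β x (f x))‖ := by
        rw [map_sub]; abel_nf
    _ ≤ ‖β y (f y - f x)‖ + ‖β y (f x) - β x (f x)‖ := norm_add_le _ _
    _ = _ := by rw [StarAlgEquiv.norm_map]

theorem continuous_family_symm_apply {X D : Type*} [TopologicalSpace X] [CStarAlgebra D]
    (β : X → D ≃⋆ₐ[ℂ] D) (hβ : ∀ d, Continuous fun x => β x d) (d : D) :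
    Continuous fun x => (β x).symm d := by
  rw [continuous_iff_continuousAt]
  intro x
  rw [ContinuousAt, tendsto_iff_norm_sub_tendsto_zero]
  have h1 := tendsto_iff_norm_sub_tendsto_zero.1 ((hβ ((β x).symm d)).tendsto x)
  refine squeeze_zero (fun _ => norm_nonneg _) (fun y => le_of_eq ?_) h1
  rw [← StarAlgEquiv.norm_map (β y), map_sub, StarAlgEquiv.apply_symm_apply,
    StarAlgEquiv.apply_symm_apply, norm_sub_rev]

/-- The automorphism `α` of `C(X, D)` over the homeomorphism `h` that is given by a pointwise
continuous family `x ↦ β x` of automorphisms of `D`: `α(a)(x) = β x (a (h⁻¹ x))`. -/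
noncomputable def automorphismOver {X D : Type*} [TopologicalSpace X] [CStarAlgebra D]
    (h : X ≃ₜ X) (β : X → D ≃⋆ₐ[ℂ] D) (hβ : ∀ d, Continuous fun x => β x d) :
    C(X, D) ≃⋆ₐ[ℂ] C(X, D) where
  toFun a := ⟨fun x => β x (a (h.symm x)),
    continuous_family_apply β hβ _ (a.continuous.comp h.symm.continuous)⟩
  invFun a := ⟨fun x => (β (h x)).symm (a (h x)),
    (continuous_family_apply (fun x => (β x).symm) (continuous_family_symm_apply β hβ) _
      a.continuous).comp h.continuous⟩
  left_inv a := by ext x; simp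
  right_inv a := by ext x; simp
  map_mul' a b := by ext x; simp
  map_add' a b := by ext x; simp
  map_star' a := by ext x; simp [map_star]
  map_smul' c a := by ext x; simp

/-! ### The crossed product by an automorphism -/

/-- A covariant representation of `(ℤ, A, α)` on a nonzero Hilbert space. -/
structure CovariantRep.{u} {A : Type u} [CStarAlgebra A] (α : A ≃⋆ₐ[ℂ] A) : Type (u + 1) where
  H : Type u
  [instNormedAddCommGroup : NormedAddCommGroup H]
  [instInnerProductSpace : InnerProductSpace ℂ H]
  [instCompleteSpace : CompleteSpace H]
  [instNontrivial : Nontrivial H]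
  π : A →⋆ₐ[ℂ] (H →L[ℂ] H)
  u : unitary (H →L[ℂ] H)
  covariant : ∀ a, (u : H →L[ℂ] H) * π a * star (u : H →L[ℂ] H) = π (α a)

attribute [instance] CovariantRep.instNormedAddCommGroup CovariantRep.instInnerProductSpace
  CovariantRep.instCompleteSpace CovariantRep.instNontrivial

section CrossedProduct

universe u

variable {A : Type u} [CStarAlgebra A] (α : A ≃⋆ₐ[ℂ] A)

/-- The C*-algebra of bounded families of operators, one for every covariant representation. -/
abbrev CovariantRep.Ambient : Type (u + 1) :=
  lp (fun i : CovariantRep α => i.H →L[ℂ] i.H) ∞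

noncomputable instance CovariantRep.instCStarAlgebra : CStarAlgebra (CovariantRep.Ambient α) where

/-- The direct sum of the representations of `A` in all covariant representations. -/
noncomputable def CovariantRep.sumRep : A →⋆ₐ[ℂ] CovariantRep.Ambient α where
  toFun a := ⟨fun i => i.π a, memℓp_infty ⟨‖a‖, by
    rintro _ ⟨i, rfl⟩
    exact NonUnitalStarAlgHom.norm_apply_le i.π a⟩⟩
  map_one' := by ext i : 2; exact map_one i.π
  map_mul' a b := by ext i : 2; exact map_mul i.π a b
  map_zero' := by ext i : 2; exact map_zero i.π
  map_add' a b := by ext i : 2; exact map_add i.π a b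
  commutes' c := by ext i : 2; exact AlgHomClass.commutes i.π c
  map_star' a := by ext i : 2; exact map_star i.π a

/-- The direct sum of the unitaries of all covariant representations. -/
noncomputable def CovariantRep.sumUnitary : unitary (CovariantRep.Ambient α) :=
  ⟨⟨fun i => (i.u : i.H →L[ℂ] i.H), memℓp_infty ⟨1, by
    rintro _ ⟨i, rfl⟩
    exact (CStarRing.norm_coe_unitary i.u).le⟩⟩, by
    rw [Unitary.mem_iff]
    constructor
    · ext i : 2; exact Unitary.coe_star_mul_self i.u
    · ext i : 2; exact Unitary.coe_mul_star_self i.u⟩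

/-- The C*-algebra generated by the images of `A` and of the canonical unitary in the direct sum of
all covariant representations. -/
noncomputable def CrossedProduct.carrier : StarSubalgebra ℂ (CovariantRep.Ambient α) :=
  (StarAlgebra.adjoin ℂ
    (range (CovariantRep.sumRep α) ∪
      {(CovariantRep.sumUnitary α : CovariantRep.Ambient α)})).topologicalClosure

instance CrossedProduct.instIsClosed :
    IsClosed (CrossedProduct.carrier α : Set (CovariantRep.Ambient α)) :=
  StarSubalgebra.isClosed_topologicalClosure _

/-- The (full) crossed product `C*(ℤ, A, α)`, as the C*-algebra generated by `A` and the canonical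
unitary in the direct sum of all covariant representations. So the norm of `∑ aₙ uⁿ` is the
supremum of its norms in all covariant representations. -/
def CrossedProduct : Type (u + 1) := CrossedProduct.carrier α

noncomputable instance CrossedProduct.instCStarAlgebra : CStarAlgebra (CrossedProduct α) :=
  inferInstanceAs (CStarAlgebra (CrossedProduct.carrier α))

/-- The canonical map `A → C*(ℤ, A, α)`. -/
noncomputable def CrossedProduct.ι : A →⋆ₐ[ℂ] CrossedProduct α :=
  ((CovariantRep.sumRep α).codRestrict (CrossedProduct.carrier α) fun a =>
    StarSubalgebra.le_topologicalClosure _ (StarAlgebra.subset_adjoin ℂ _ (Or.inl ⟨a, rfl⟩)) :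
    A →⋆ₐ[ℂ] CrossedProduct.carrier α)

/-- The canonical unitary of `C*(ℤ, A, α)`, which implements `α`. -/
noncomputable def CrossedProduct.u : unitary (CrossedProduct α) :=
  (⟨⟨(CovariantRep.sumUnitary α : CovariantRep.Ambient α),
    StarSubalgebra.le_topologicalClosure _ (StarAlgebra.subset_adjoin ℂ _ (Or.inr rfl))⟩, by
    rw [Unitary.mem_iff]
    exact ⟨Subtype.ext (Unitary.coe_star_mul_self (CovariantRep.sumUnitary α)),
      Subtype.ext (Unitary.coe_mul_star_self (CovariantRep.sumUnitary α))⟩⟩ :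
    unitary (CrossedProduct.carrier α))

/-- The canonical unitary implements the automorphism. -/
theorem CrossedProduct.u_mul_ι_mul_star_u (a : A) :
    (CrossedProduct.u α : CrossedProduct α) * CrossedProduct.ι α a *
      star (CrossedProduct.u α : CrossedProduct α) = CrossedProduct.ι α (α a) := by
  apply Subtype.ext
  ext i : 2
  exact i.covariant a

/-- `E` is the standard conditional expectation `C*(ℤ, A, α) → A`: the continuous linear map
that sends `∑ aₙ uⁿ` to `a₀`. -/
def CrossedProduct.IsStandardExpectation (E : CrossedProduct α →L[ℂ] A) : Prop :=
  ∀ (a : A) (n : ℤ),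
    E (CrossedProduct.ι α a * ((CrossedProduct.u α ^ n : unitary (CrossedProduct α)) :
      CrossedProduct α)) = if n = 0 then a else 0

end CrossedProduct

/-! ### The regular representation -/

section Regular

universe u v

/-! The expectation is read off from regular representations. For a representation `π` of `A`,
compressing the induced representation on `ℓ²(ℤ, H)` to the coordinate zero kills `a uⁿ` for `n ≠ 0`
and returns `π a` for `n = 0`. So the zeroth coefficient of a finite sum is bounded by the norm of
the sum as soon as enough `π` are available. Since `D` is simple, `σ` is faithful and its GNS
representation is injective; composed with the point evaluations it detects the norm of `C(X, D)`.
The same compression, at the GNS vector, gives `0 ≤ σ (E (star a * a) x)`.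

Uniqueness of `σ` makes it invariant under every automorphism of `D`, so integrating `σ` against an
`h`-invariant measure gives an `α`-invariant trace on `C(X, D)`. Composed with `E`, this is a trace
(`IsStandardExpectation.trace_mul_comm`).

Conversely, let `τ` be a tracial state. An infinite minimal system has no periodic points, and this
forces `τ` to vanish at `a uⁿ` for `n ≠ 0` (`trace_monomial_eq_zero`); hence `τ` is determined on
`C(X, D)`. There, for fixed `f ≥ 0`, the functional `d ↦ τ(f d)` is a positive trace on `D`, so it
is a multiple of `σ` (`trace_ι_smul_const`). The factor `τ(f)` is integration against a measure by
Riesz, and this measure is invariant because `u` implements `α`.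

The values of `τ_μ` at scalar functions are the integrals defining weak convergence, so the
bijection is a homeomorphism. -/

theorem Memℓp.comp_equiv {I G : Type*} [NormedAddCommGroup G] {f : I → G}
    (hf : Memℓp f 2) (e : I ≃ I) :
    Memℓp (fun i => f (e i)) 2 := by
  rw [memℓp_gen_iff (by norm_num)] at hf ⊢
  exact (e.summable_iff (f := fun i => ‖f i‖ ^ (2 : ℝ≥0∞).toReal)).2 hf

variable {H : Type v} [NormedAddCommGroup H] [InnerProductSpace ℂ H]

/-- The Hilbert space `ℓ²(ℤ, H)`, in a universe that can be adjusted. -/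
abbrev BilateralSeq.{w, z} (H : Type z) [NormedAddCommGroup H] : Type (max w z) :=
  lp (fun _ : ULift.{w} ℤ => H) 2

/-- Translation of the index by one. -/
def ULift.intShift : ULift.{u} ℤ ≃ ULift.{u} ℤ where
  toFun k := ⟨k.down + 1⟩
  invFun k := ⟨k.down - 1⟩
  left_inv k := by ext; simp
  right_inv k := by ext; simp

/-- Reindexing of a square-summable family along a permutation of the index set. -/
noncomputable def lp.reindexTwo {I : Type u} (e : I ≃ I) :
    lp (fun _ : I => H) 2 ≃ₗᵢ[ℂ] lp (fun _ : I => H) 2 where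
  toFun f := ⟨fun i => f (e i), (lp.memℓp f).comp_equiv e⟩
  invFun f := ⟨fun i => f (e.symm i), (lp.memℓp f).comp_equiv e.symm⟩
  map_add' f g := by ext; rfl
  map_smul' c f := by ext; rfl
  left_inv f := by ext i; simp
  right_inv f := by ext i; simp
  norm_map' f := by
    rw [lp.norm_eq_tsum_rpow (by norm_num), lp.norm_eq_tsum_rpow (by norm_num)]
    congr 1
    exact e.tsum_eq (fun i => ‖f i‖ ^ (2 : ℝ≥0∞).toReal)

@[simp]
theorem lp.reindexTwo_apply {I : Type u} (e : I ≃ I) (f : lp (fun _ : I => H) 2) (i : I) :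
    lp.reindexTwo e f i = f (e i) := rfl

variable [CompleteSpace H]

/-- The bilateral shift `(S ξ)(k) = ξ(k - 1)`. -/
noncomputable def bilateralShift (H : Type v) [NormedAddCommGroup H] [InnerProductSpace ℂ H]
    [CompleteSpace H] : unitary (BilateralSeq.{u} H →L[ℂ] BilateralSeq.{u} H) :=
  Unitary.linearIsometryEquiv.symm (lp.reindexTwo ULift.intShift.symm)

theorem bilateralShift_apply (ξ : BilateralSeq.{u} H) (k : ULift.{u} ℤ) :
    (bilateralShift H : BilateralSeq.{u} H →L[ℂ] BilateralSeq.{u} H) ξ k = ξ ⟨k.down - 1⟩ := rfl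

theorem star_bilateralShift_apply (ξ : BilateralSeq.{u} H) (k : ULift.{u} ℤ) :
    (star (bilateralShift H : BilateralSeq.{u} H →L[ℂ] BilateralSeq.{u} H)) ξ k
      = ξ ⟨k.down + 1⟩ := by
  have h : (star (bilateralShift H : BilateralSeq.{u} H →L[ℂ] BilateralSeq.{u} H))
      ((bilateralShift H : BilateralSeq.{u} H →L[ℂ] BilateralSeq.{u} H)
        (lp.reindexTwo ULift.intShift ξ)) = lp.reindexTwo ULift.intShift ξ := by
    rw [← mul_apply_eq_comp, Unitary.coe_star_mul_self]; rfl
  have h' : (bilateralShift H : BilateralSeq.{u} H →L[ℂ] BilateralSeq.{u} H)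
        (lp.reindexTwo ULift.intShift ξ) = ξ := by
    ext k
    rw [bilateralShift_apply, lp.reindexTwo_apply]
    simp [ULift.intShift]
  rw [h'] at h
  rw [h]; rfl

theorem bilateralShift_zpow_apply (n : ℤ) (ξ : BilateralSeq.{u} H) (k : ULift.{u} ℤ) :
    ((bilateralShift H ^ n : unitary (BilateralSeq.{u} H →L[ℂ] BilateralSeq.{u} H)) :
      BilateralSeq.{u} H →L[ℂ] BilateralSeq.{u} H) ξ k = ξ ⟨k.down - n⟩ := by
  induction n using Int.induction_on generalizing ξ with
  | zero => simp
  | succ n ih =>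
    rw [zpow_add_one, Submonoid.coe_mul, mul_apply_eq_comp, ih, bilateralShift_apply,
      sub_sub]
  | pred n ih =>
    rw [zpow_sub_one, Submonoid.coe_mul, mul_apply_eq_comp, ih]
    rw [← Unitary.star_eq_inv, Unitary.coe_star, star_bilateralShift_apply,
      show k.down - (-(n : ℤ) - 1) = k.down - -(n : ℤ) + 1 by ring]

/-- The diagonal representation on `ℓ²(ℤ, H)` given by a sequence of representations on `H`. -/
noncomputable def diagonalRep {A : Type*} [CStarAlgebra A]
    (π : ULift.{u} ℤ → A →⋆ₐ[ℂ] (H →L[ℂ] H)) :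
    A →⋆ₐ[ℂ] (BilateralSeq.{u} H →L[ℂ] BilateralSeq.{u} H) where
  toFun a := lp.mapCLM 2 (fun k => π k a) (norm_nonneg a)
    (fun k => NonUnitalStarAlgHom.norm_apply_le (π k) a)
  map_one' := by ext; simp
  map_mul' a b := by ext; simp
  map_zero' := by ext; simp
  map_add' a b := by ext; simp
  commutes' c := by ext; simp [Algebra.algebraMap_eq_smul_one]
  map_star' a := by
    rw [ContinuousLinearMap.star_eq_adjoint, ContinuousLinearMap.eq_adjoint_iff]
    intro x y
    rw [lp.inner_eq_tsum, lp.inner_eq_tsum]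
    congr 1
    ext k
    simp [map_star, ContinuousLinearMap.star_eq_adjoint, ContinuousLinearMap.adjoint_inner_left]

theorem diagonalRep_apply {A : Type*} [CStarAlgebra A] (π : ULift.{u} ℤ → A →⋆ₐ[ℂ] (H →L[ℂ] H))
    (a : A) (ξ : BilateralSeq.{u} H) (k : ULift.{u} ℤ) : diagonalRep π a ξ k = π k a (ξ k) := rfl

variable {A : Type (max u v)} [CStarAlgebra A] (α : A ≃⋆ₐ[ℂ] A) [Nontrivial H]

instance : Nontrivial (BilateralSeq.{u} H) := by
  classical
  obtain ⟨x, hx⟩ := exists_ne (0 : H)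
  refine ⟨lp.single 2 ⟨0⟩ x, 0, fun h => hx ?_⟩
  have := lp.single_apply_self (E := fun _ : ULift.{u} ℤ => H) 2 ⟨0⟩ x
  rw [h] at this
  exact this.symm

/-- The regular covariant representation of `(ℤ, A, α)` induced by a representation of `A`. -/
noncomputable def CovariantRep.regular (π : A →⋆ₐ[ℂ] (H →L[ℂ] H)) : CovariantRep α where
  -- A covariant representation has to live in the universe of `A`; the lifted index set puts `ℓ²(ℤ,
  -- H)` there.
  H := BilateralSeq.{u} H
  π := diagonalRep fun k => π.comp ((α ^ (-k.down) : A ≃⋆ₐ[ℂ] A) : A →⋆ₐ[ℂ] A)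
  u := bilateralShift H
  covariant a := by
    ext ξ k
    rw [mul_apply_eq_comp, mul_apply_eq_comp, bilateralShift_apply,
      diagonalRep_apply, star_bilateralShift_apply, diagonalRep_apply]
    -- Conjugating by the shift replaces the `k`-th block by the block at `k - 1`. With exponent
    -- `-k` in block `k`, this amounts to applying `α` first.
    have h : (α ^ (-(k.down - 1))) a = (α ^ (-k.down)) (α a) := by
      rw [← StarAlgEquiv.mul_apply, ← zpow_add_one]
      congr 2; ring
    change π ((α ^ (-(k.down - 1))) a) (ξ ⟨k.down - 1 + 1⟩) = π ((α ^ (-k.down)) (α a)) (ξ k)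
    rw [h, sub_add_cancel]

end Regular

/-! ### Structure of the crossed product -/

namespace CrossedProduct

universe u v

variable {A : Type u} [CStarAlgebra A] (α : A ≃⋆ₐ[ℂ] A)

/-- The representation of the crossed product given by a covariant representation. -/
noncomputable def rep (i : CovariantRep α) : CrossedProduct α →⋆ₐ[ℂ] (i.H →L[ℂ] i.H) where
  toFun a := a.1 i
  map_one' := rfl
  map_mul' _ _ := rfl
  map_zero' := rfl
  map_add' _ _ := rfl
  commutes' _ := rfl
  map_star' _ := rfl

/-- The element `a uⁿ` of the crossed product. -/
noncomputable def monomial (n : ℤ) : A →ₗ[ℂ] CrossedProduct α where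
  toFun a := ι α a * ((u α ^ n : unitary (CrossedProduct α)) : CrossedProduct α)
  map_add' a b := by rw [map_add, add_mul]
  map_smul' c a := by rw [map_smul, smul_mul_assoc, RingHom.id_apply]

theorem monomial_apply (n : ℤ) (a : A) :
    monomial α n a = ι α a * ((u α ^ n : unitary (CrossedProduct α)) : CrossedProduct α) := rfl

theorem monomial_zero (a : A) : monomial α 0 a = ι α a := by
  simp [monomial_apply]

theorem u_mul_ι (a : A) :
    (u α : CrossedProduct α) * ι α a = ι α (α a) * (u α : CrossedProduct α) := by
  rw [← u_mul_ι_mul_star_u, mul_assoc, Unitary.coe_star_mul_self, mul_one]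

theorem star_u_mul_ι (a : A) :
    star (u α : CrossedProduct α) * ι α a = ι α (α.symm a) * star (u α : CrossedProduct α) := by
  have h := u_mul_ι α (α.symm a)
  rw [StarAlgEquiv.apply_symm_apply] at h
  calc star (u α : CrossedProduct α) * ι α a
      = star (u α : CrossedProduct α) * (ι α a * u α) * star (u α : CrossedProduct α) := by
        rw [← mul_assoc, mul_assoc _ _ (star _), Unitary.mul_star_self_of_mem (u α).2, mul_one]
    _ = _ := by rw [← h, ← mul_assoc, Unitary.coe_star_mul_self, one_mul]

theorem zpow_u_mul_ι (n : ℤ) (a : A) :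
    ((u α ^ n : unitary (CrossedProduct α)) : CrossedProduct α) * ι α a =
      ι α ((α ^ n) a) * ((u α ^ n : unitary (CrossedProduct α)) : CrossedProduct α) := by
  induction n using Int.induction_on generalizing a with
  | zero => simp
  | succ n ih =>
    rw [zpow_add_one, Submonoid.coe_mul, mul_assoc, u_mul_ι, ← mul_assoc, ih, zpow_add_one,
      mul_assoc, StarAlgEquiv.mul_apply]
  | pred n ih =>
    rw [zpow_sub_one, Submonoid.coe_mul, mul_assoc, ← Unitary.star_eq_inv, Unitary.coe_star,
      star_u_mul_ι, ← mul_assoc, ih, zpow_sub_one, mul_assoc, StarAlgEquiv.mul_apply]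
    rfl

theorem monomial_mul_monomial (m n : ℤ) (a b : A) :
    monomial α m a * monomial α n b = monomial α (m + n) (a * (α ^ m) b) := by
  rw [monomial_apply, monomial_apply, monomial_apply, mul_assoc, ← mul_assoc _ (ι α b),
    zpow_u_mul_ι, zpow_add, Submonoid.coe_mul, map_mul]
  simp only [mul_assoc]

theorem star_monomial (n : ℤ) (a : A) :
    star (monomial α n a) = monomial α (-n) ((α ^ (-n)) (star a)) := by
  rw [monomial_apply, monomial_apply, star_mul, ← map_star, ← Unitary.coe_star,
    Unitary.star_eq_inv, ← zpow_neg, zpow_u_mul_ι]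

/-- Finite sums `∑ aₙ uⁿ`. -/
noncomputable def polynomial : (ℤ →₀ A) →ₗ[ℂ] CrossedProduct α :=
  Finsupp.lsum ℂ (monomial α)

@[simp]
theorem polynomial_single (n : ℤ) (a : A) :
    polynomial α (Finsupp.single n a) = monomial α n a := by
  simp [polynomial]

theorem monomial_mem_range (n : ℤ) (a : A) :
    monomial α n a ∈ LinearMap.range (polynomial α) := ⟨Finsupp.single n a, by simp⟩

theorem range_polynomial_eq_span :
    LinearMap.range (polynomial α) =
      Submodule.span ℂ {x | ∃ n a, x = monomial α n a} := by
  apply le_antisymm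
  · rintro _ ⟨c, rfl⟩
    rw [polynomial, Finsupp.lsum_apply]
    exact Submodule.sum_mem _ fun n _ => Submodule.subset_span ⟨n, _, rfl⟩
  · rw [Submodule.span_le]
    rintro _ ⟨n, a, rfl⟩
    exact monomial_mem_range α n a

theorem mul_mem_range {x y : CrossedProduct α} (hx : x ∈ LinearMap.range (polynomial α))
    (hy : y ∈ LinearMap.range (polynomial α)) : x * y ∈ LinearMap.range (polynomial α) := by
  rw [range_polynomial_eq_span] at hx hy
  induction hx, hy using Submodule.span_induction₂ with
  | mem_mem x y hx hy =>
    obtain ⟨m, a, rfl⟩ := hx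
    obtain ⟨n, b, rfl⟩ := hy
    rw [monomial_mul_monomial]
    exact monomial_mem_range ..
  | zero_left => simp
  | zero_right => simp
  | add_left x y z _ _ _ h₁ h₂ => rw [add_mul]; exact add_mem h₁ h₂
  | add_right x y z _ _ _ h₁ h₂ => rw [mul_add]; exact add_mem h₁ h₂
  | smul_left c x y _ _ h => rw [smul_mul_assoc]; exact Submodule.smul_mem _ _ h
  | smul_right c x y _ _ h => rw [mul_smul_comm]; exact Submodule.smul_mem _ _ h

theorem star_mem_range {x : CrossedProduct α} (hx : x ∈ LinearMap.range (polynomial α)) :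
    star x ∈ LinearMap.range (polynomial α) := by
  rw [range_polynomial_eq_span] at hx
  induction hx using Submodule.span_induction with
  | mem x hx =>
    obtain ⟨m, a, rfl⟩ := hx
    rw [star_monomial]
    exact monomial_mem_range ..
  | zero => simp
  | add x y _ _ h₁ h₂ => rw [star_add]; exact add_mem h₁ h₂
  | smul c x _ h => rw [star_smul]; exact Submodule.smul_mem _ _ h

theorem ι_mem_range (a : A) : ι α a ∈ LinearMap.range (polynomial α) := by
  rw [← monomial_zero]; exact monomial_mem_range ..

theorem u_mem_range : (u α : CrossedProduct α) ∈ LinearMap.range (polynomial α) := by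
  have := monomial_mem_range α 1 1
  rwa [monomial_apply, map_one, one_mul, zpow_one] at this

/-- Finite sums `∑ aₙ uⁿ` already form a star subalgebra containing the generators, by the
commutation rule for `uⁿ` and `A`; hence they are dense in the crossed product. -/
theorem mem_range_of_mem_adjoin {x : CovariantRep.Ambient α}
    (hx : x ∈ StarAlgebra.adjoin ℂ (range (CovariantRep.sumRep α) ∪
      {(CovariantRep.sumUnitary α : CovariantRep.Ambient α)})) :
    ∃ y ∈ LinearMap.range (polynomial α), (y : CrossedProduct α).1 = x := by
  induction hx using StarAlgebra.adjoin_induction with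
  | mem x hx =>
    rcases hx with ⟨a, rfl⟩ | rfl
    · exact ⟨_, ι_mem_range α a, rfl⟩
    · exact ⟨_, u_mem_range α, rfl⟩
  | algebraMap r =>
    refine ⟨r • 1, Submodule.smul_mem _ _ ?_, ?_⟩
    · rw [← map_one (ι α)]; exact ι_mem_range α 1
    · rw [Algebra.algebraMap_eq_smul_one]; rfl
  | add x y _ _ hx hy =>
    obtain ⟨x, hx, rfl⟩ := hx
    obtain ⟨y, hy, rfl⟩ := hy
    exact ⟨x + y, add_mem hx hy, rfl⟩
  | mul x y _ _ hx hy =>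
    obtain ⟨x, hx, rfl⟩ := hx
    obtain ⟨y, hy, rfl⟩ := hy
    exact ⟨x * y, mul_mem_range α hx hy, rfl⟩
  | star x _ hx =>
    obtain ⟨x, hx, rfl⟩ := hx
    exact ⟨star x, star_mem_range α hx, rfl⟩

theorem denseRange_polynomial : DenseRange (polynomial α) := by
  intro x
  have hx : x.1 ∈ closure (StarAlgebra.adjoin ℂ (range (CovariantRep.sumRep α) ∪
      {(CovariantRep.sumUnitary α : CovariantRep.Ambient α)}) : Set (CovariantRep.Ambient α)) := x.2
  rw [Metric.mem_closure_iff] at hx ⊢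
  intro ε hε
  obtain ⟨b, hb, hd⟩ := hx ε hε
  obtain ⟨y, hy, rfl⟩ := mem_range_of_mem_adjoin α hb
  exact ⟨y, hy, hd⟩

variable {α} in
/-- Continuous linear maps on the crossed product are determined by their values at `a uⁿ`. -/
theorem clm_ext {F : Type*} [AddCommGroup F] [Module ℂ F] [TopologicalSpace F] [T2Space F]
    {S T : CrossedProduct α →L[ℂ] F} (h : ∀ n a, S (monomial α n a) = T (monomial α n a)) :
    S = T := by
  apply ContinuousLinearMap.coeFn_injective
  refine (denseRange_polynomial α).equalizer S.continuous T.continuous ?_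
  have : S.toLinearMap ∘ₗ polynomial α = T.toLinearMap ∘ₗ polynomial α := by
    ext n a
    simpa using h n a
  funext c
  exact LinearMap.congr_fun this c

end CrossedProduct

/-! ### The standard conditional expectation -/

theorem StarAlgHom.continuous_of_cstarAlgebra {A B : Type*} [CStarAlgebra A] [CStarAlgebra B]
    (π : A →⋆ₐ[ℂ] B) : Continuous π :=
  AddMonoidHomClass.continuous_of_bound π 1 fun x => by
    rw [one_mul]; exact NonUnitalStarAlgHom.norm_apply_le π x

namespace CrossedProduct

universe u v

theorem rep_ι {A : Type u} [CStarAlgebra A] (α : A ≃⋆ₐ[ℂ] A) (i : CovariantRep α) (a : A) :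
    rep α i (ι α a) = i.π a := rfl

theorem rep_zpow_u {A : Type u} [CStarAlgebra A] (α : A ≃⋆ₐ[ℂ] A) (i : CovariantRep α) (n : ℤ) :
    rep α i ((u α ^ n : unitary (CrossedProduct α)) : CrossedProduct α) =
      ((i.u ^ n : unitary (i.H →L[ℂ] i.H)) : i.H →L[ℂ] i.H) :=
  congrArg Subtype.val (map_zpow (Unitary.map (StarMonoidHom.ofClass (rep α i))) (u α) n)

section Regular

variable {H : Type v} [NormedAddCommGroup H] [InnerProductSpace ℂ H] [CompleteSpace H]
  [Nontrivial H] {A : Type (max u v)} [CStarAlgebra A] (α : A ≃⋆ₐ[ℂ] A) (π : A →⋆ₐ[ℂ] (H →L[ℂ] H))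

/-- The representation of the crossed product on `ℓ²(ℤ, H)` induced by a representation of `A`
on `H`. -/
noncomputable def regularRep :
    CrossedProduct α →⋆ₐ[ℂ] (BilateralSeq.{u} H →L[ℂ] BilateralSeq.{u} H) :=
  rep α (CovariantRep.regular.{u, v} α π)

/-- The embedding of `H` into `ℓ²(ℤ, H)` at the index zero. -/
noncomputable def atZero : H →L[ℂ] BilateralSeq.{u} H :=
  lp.singleContinuousLinearMap ℂ (fun _ : ULift.{u} ℤ => H) 2 ⟨0⟩

/-- The compression of the regular representation to the index zero. -/
noncomputable def compression (ξ : H) : CrossedProduct α →L[ℂ] H where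
  toFun x := regularRep.{u, v} α π x (atZero.{u, v} ξ) ⟨0⟩
  map_add' x y := by rw [map_add]; rfl
  map_smul' c x := by rw [map_smul]; rfl
  cont := by
    have h1 : Continuous fun x => regularRep.{u, v} α π x (atZero.{u, v} ξ) :=
      (regularRep.{u, v} α π).continuous_of_cstarAlgebra.clm_apply continuous_const
    exact (lp.evalCLM ℂ (fun _ : ULift.{u} ℤ => H) 2 ⟨0⟩).continuous.comp h1

theorem compression_apply (ξ : H) (x : CrossedProduct α) :
    compression.{u, v} α π ξ x = regularRep.{u, v} α π x (atZero.{u, v} ξ) ⟨0⟩ := rfl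

/-- The power `uⁿ` moves the vector from index zero to index `n`, and the diagonal action of `a`
keeps it there. -/
theorem compression_monomial (ξ : H) (n : ℤ) (a : A) :
    compression.{u, v} α π ξ (monomial α n a) = if n = 0 then π a ξ else 0 := by
  have h : regularRep.{u, v} α π (monomial α n a) = (CovariantRep.regular.{u, v} α π).π a *
      (((CovariantRep.regular.{u, v} α π).u ^ n : unitary _) : _ →L[ℂ] _) := by
    refine (map_mul (rep α (CovariantRep.regular.{u, v} α π)) _ _).trans ?_
    rw [rep_ι, rep_zpow_u]
    rfl
  rw [compression_apply, h]
  change diagonalRep (fun k : ULift.{u} ℤ => π.comp ((α ^ (-k.down) : A ≃⋆ₐ[ℂ] A) : A →⋆ₐ[ℂ] A)) a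
    (((bilateralShift H ^ n : unitary (BilateralSeq.{u} H →L[ℂ] BilateralSeq.{u} H)) :
      BilateralSeq.{u} H →L[ℂ] BilateralSeq.{u} H) (atZero.{u, v} ξ)) ⟨0⟩ = _
  rw [diagonalRep_apply, bilateralShift_zpow_apply]
  change π ((α ^ (-(0 : ℤ))) a) (lp.single (E := fun _ : ULift.{u} ℤ => H) 2 ⟨0⟩ ξ ⟨0 - n⟩) = _
  by_cases hn : n = 0
  · subst hn
    simp
  · rw [lp.single_apply_ne _ _ _ (by simpa [ULift.ext_iff] using hn), map_zero, if_neg hn]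

theorem norm_compression_le (ξ : H) (x : CrossedProduct α) :
    ‖compression.{u, v} α π ξ x‖ ≤ ‖x‖ * ‖ξ‖ := by
  calc ‖compression.{u, v} α π ξ x‖ ≤ ‖regularRep.{u, v} α π x (atZero.{u, v} ξ)‖ :=
        lp.norm_apply_le_norm (by norm_num) _ _
    _ ≤ ‖regularRep.{u, v} α π x‖ * ‖atZero.{u, v} ξ‖ := ContinuousLinearMap.le_opNorm _ _
    _ ≤ ‖x‖ * ‖ξ‖ := by
        gcongr
        · exact NonUnitalStarAlgHom.norm_apply_le (regularRep.{u, v} α π) x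
        · exact (lp.norm_single (E := fun _ : ULift.{u} ℤ => H) (by norm_num) _ _).le

theorem compression_polynomial (ξ : H) (c : ℤ →₀ A) :
    compression.{u, v} α π ξ (polynomial α c) = π (c 0) ξ := by
  induction c using Finsupp.induction_linear with
  | zero => simp
  | add f g hf hg => simp [hf, hg]
  | single n a =>
    rw [polynomial_single, compression_monomial, Finsupp.single_apply]
    split_ifs <;> simp

/-- The standard conditional expectation exists if `A` has a family of representations that
determines the norm. -/
theorem exists_isStandardExpectation {κ : Type*} (π : κ → A →⋆ₐ[ℂ] (H →L[ℂ] H))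
    (hπ : ∀ (a : A) (C : ℝ), 0 ≤ C → (∀ k, ‖π k a‖ ≤ C) → ‖a‖ ≤ C) :
    ∃ E : CrossedProduct α →L[ℂ] A, IsStandardExpectation α E := by
  -- This bound makes the zeroth coefficient well defined on the dense set of finite sums and lets
  -- it extend continuously.
  have hbound : ∀ c : ℤ →₀ A, ‖Finsupp.lapply (R := ℂ) 0 c‖ ≤ 1 * ‖polynomial α c‖ := by
    intro c
    rw [one_mul]
    refine hπ _ _ (norm_nonneg _) fun k => ContinuousLinearMap.opNorm_le_bound _ (norm_nonneg _) ?_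
    intro ξ
    rw [Finsupp.lapply_apply, ← compression_polynomial.{u, v} α (π k) ξ c]
    exact norm_compression_le.{u, v} α (π k) ξ _
  refine ⟨(Finsupp.lapply (R := ℂ) 0).extendOfNorm (polynomial α), fun a n => ?_⟩
  rw [← monomial_apply, ← polynomial_single,
    LinearMap.extendOfNorm_eq (denseRange_polynomial α) ⟨1, hbound⟩, Finsupp.lapply_apply,
    Finsupp.single_apply]

theorem IsStandardExpectation.compression_eq {E : CrossedProduct α →L[ℂ] A}
    (hE : IsStandardExpectation α E) (ξ : H) (x : CrossedProduct α) :
    compression.{u, v} α π ξ x = π (E x) ξ := by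
  let T : CrossedProduct α →L[ℂ] H :=
    ⟨(LinearMap.applyₗ ξ ∘ₗ ContinuousLinearMap.coeLM ℂ) ∘ₗ π.toAlgHom.toLinearMap ∘ₗ E.toLinearMap,
      (π.continuous_of_cstarAlgebra.comp E.continuous).clm_apply continuous_const⟩
  have : compression.{u, v} α π ξ = T := by
    refine clm_ext fun n a => ?_
    rw [compression_monomial]
    change _ = π (E (monomial α n a)) ξ
    rw [monomial_apply, hE a n]
    split_ifs <;> simp
  rw [this]; rfl

/-- The inner product is the squared norm of the vector obtained by letting `x` act on `ξ` placed at
index zero. -/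
theorem IsStandardExpectation.inner_nonneg {E : CrossedProduct α →L[ℂ] A}
    (hE : IsStandardExpectation α E) (ξ : H) (x : CrossedProduct α) :
    0 ≤ inner ℂ ξ (π (E (star x * x)) ξ) := by
  rw [← hE.compression_eq.{u, v} α π, compression_apply]
  have h := lp.inner_single_left (𝕜 := ℂ) (G := fun _ : ULift.{u} ℤ => H) ⟨0⟩ ξ
    (regularRep.{u, v} α π (star x * x) (atZero.{u, v} ξ))
  rw [← h, map_mul, map_star, mul_apply_eq_comp, ContinuousLinearMap.star_eq_adjoint]
  change 0 ≤ inner ℂ (atZero.{u, v} ξ) _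
  rw [ContinuousLinearMap.adjoint_inner_right, inner_self_eq_norm_sq_to_K,
    ← RCLike.ofReal_pow]
  exact Complex.zero_le_real.2 (sq_nonneg _)

end Regular

variable {A : Type u} [CStarAlgebra A] {α : A ≃⋆ₐ[ℂ] A}

theorem IsStandardExpectation.unique {E F : CrossedProduct α →L[ℂ] A}
    (hE : IsStandardExpectation α E) (hF : IsStandardExpectation α F) : E = F :=
  clm_ext fun n a => (hE a n).trans (hF a n).symm

theorem IsStandardExpectation.apply_monomial {E : CrossedProduct α →L[ℂ] A}
    (hE : IsStandardExpectation α E) (n : ℤ) (a : A) :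
    E (monomial α n a) = if n = 0 then a else 0 := hE a n

theorem IsStandardExpectation.apply_ι {E : CrossedProduct α →L[ℂ] A}
    (hE : IsStandardExpectation α E) (a : A) : E (ι α a) = a := by
  rw [← monomial_zero, hE.apply_monomial, if_pos rfl]

end CrossedProduct

/-! ### The GNS representation of a trace on a simple algebra -/

section Trace

universe v

variable {D : Type v} [CStarAlgebra D]

/-- The null set of `σ` absorbs left multiplication because `x* d* d x ≤ ‖d* d‖ x* x`. -/
theorem apply_star_mul_self_mul_eq_zero {σ : WeakDual ℂ D} (hσ : σ ∈ tracialStates D) (d x : D)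
    (hx : σ (star x * x) = 0) : σ (star (d * x) * (d * x)) = 0 := by
  let _ : PartialOrder D := CStarAlgebra.spectralOrder D
  let _ : StarOrderedRing D := CStarAlgebra.spectralOrderedRing D
  have hpos : ∀ y : D, 0 ≤ y → 0 ≤ σ y := by
    intro y hy
    obtain ⟨z, rfl⟩ := CStarAlgebra.nonneg_iff_eq_star_mul_self.1 hy
    exact hσ.1 z
  have hle : star x * (star d * d) * x ≤ ‖star d * d‖ • (star x * x) :=
    CStarAlgebra.star_left_conjugate_le_norm_smul
  have h2 := hpos _ (sub_nonneg.2 hle)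
  rw [← Complex.coe_smul, map_sub, map_smul, hx, smul_zero, zero_sub] at h2
  have h3 : star (d * x) * (d * x) = star x * (star d * d) * x := by
    rw [star_mul]; simp only [mul_assoc]
  have h1 := hσ.1 (d * x)
  rw [h3] at h1 ⊢
  exact le_antisymm (neg_nonneg.1 h2) h1

/-- A tracial state on a simple C*-algebra is faithful. -/
theorem IsSimpleCStarAlgebra.eq_zero_of_trace (hD : IsSimpleCStarAlgebra D) {σ : WeakDual ℂ D}
    (hσ : σ ∈ tracialStates D) {x : D} (hx : σ (star x * x) = 0) : x = 0 := by
  -- The trace property makes the null set self-adjoint, so absorption on the left gives absorption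
  -- on the right.
  have hstar : ∀ y, σ (star y * y) = 0 → σ (star (star y) * star y) = 0 := fun y hy => by
    rwa [star_star, hσ.2.2]
  have hmulr : ∀ y d, σ (star y * y) = 0 → σ (star (y * d) * (y * d)) = 0 := fun y d hy => by
    have := hstar _ (apply_star_mul_self_mul_eq_zero hσ (star d) (star y) (hstar y hy))
    rwa [star_mul, star_star, star_star] at this
  have hadd : ∀ y z, σ (star y * y) = 0 → σ (star z * z) = 0 →
      σ (star (y + z) * (y + z)) = 0 := fun y z hy hz => by
    -- By the parallelogram identity two nonnegative numbers have sum zero, which replaces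
    -- Cauchy–Schwarz.
    have h : star (y + z) * (y + z) + star (y - z) * (y - z) =
        (2 : ℂ) • (star y * y) + (2 : ℂ) • (star z * z) := by
      simp only [star_add, star_sub, two_smul]; noncomm_ring
    have h' := congrArg σ h
    rw [map_add, map_add, map_smul, map_smul, hy, hz, smul_zero, add_zero] at h'
    exact ((add_eq_zero_iff_of_nonneg (hσ.1 _) (hσ.1 _)).1 h').1
  let I : TwoSidedIdeal D := TwoSidedIdeal.mk' {y | σ (star y * y) = 0} (by simp)
    (fun {y z} hy hz => hadd y z hy hz) (fun {y} hy => by simpa using hy)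
    (fun {y z} hz => apply_star_mul_self_mul_eq_zero hσ y z hz) (fun {y z} hy => hmulr y z hy)
  have hI : ∀ y, y ∈ I ↔ σ (star y * y) = 0 := fun y => TwoSidedIdeal.mem_mk' ..
  have hclosed : IsClosed (I : Set D) := by
    have : (I : Set D) = (fun y => σ (star y * y)) ⁻¹' {0} := by ext y; exact hI y
    rw [this]
    exact isClosed_singleton.preimage (σ.continuous.comp (continuous_star.mul continuous_id))
  rcases hD.2 I hclosed with h | h
  · have : x ∈ I := (hI x).2 hx
    rw [h] at this
    simpa using this
  · have : (1 : D) ∈ I := by rw [h]; trivial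
    rw [hI, star_one, one_mul, hσ.2.1] at this
    exact absurd this one_ne_zero

/-- In the GNS representation `π d ξ` is the class of `d`, so `π d = 0` forces `σ (star d * d) = 0`,
and `σ` is faithful. -/
theorem IsSimpleCStarAlgebra.exists_faithful_rep (hD : IsSimpleCStarAlgebra D) {σ : WeakDual ℂ D}
    (hσ : σ ∈ tracialStates D) :
    ∃ (H : Type v) (_ : NormedAddCommGroup H) (_ : InnerProductSpace ℂ H) (_ : CompleteSpace H)
      (_ : Nontrivial H) (π : D →⋆ₐ[ℂ] (H →L[ℂ] H)) (ξ : H), Function.Injective π ∧ ∀ d, inner ℂ ξ (π d ξ) = σ d := by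
  let _ : PartialOrder D := CStarAlgebra.spectralOrder D
  let _ : StarOrderedRing D := CStarAlgebra.spectralOrderedRing D
  have hpos : ∀ y : D, 0 ≤ y → 0 ≤ σ y := by
    intro y hy
    obtain ⟨z, rfl⟩ := CStarAlgebra.nonneg_iff_eq_star_mul_self.1 hy
    exact hσ.1 z
  let f : D →ₚ[ℂ] ℂ := PositiveLinearMap.mk₀ (σ : D →ₗ[ℂ] ℂ) hpos
  have hf : ∀ d, f d = σ d := fun _ => rfl
  have happ : ∀ d, f.gnsStarAlgHom d ((f.toPreGNS 1 : f.PreGNS) : f.GNS) = (f.toPreGNS d : f.GNS) := by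
    intro d
    have := f.gnsNonUnitalStarAlgHom_apply_coe (a := d) (b := f.toPreGNS 1)
    refine this.trans ?_
    simp [PositiveLinearMap.leftMulMapPreGNS_apply]
  have hinner : ∀ d, inner ℂ ((f.toPreGNS 1 : f.PreGNS) : f.GNS)
      (f.gnsStarAlgHom d ((f.toPreGNS 1 : f.PreGNS) : f.GNS)) = σ d := by
    intro d
    rw [happ, UniformSpace.Completion.inner_coe, PositiveLinearMap.preGNS_inner_def]
    simp [hf]
  have hne : ((f.toPreGNS 1 : f.PreGNS) : f.GNS) ≠ 0 := by
    intro h0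
    have := hinner 1
    rw [h0, inner_zero_left, hσ.2.1] at this
    exact zero_ne_one this
  refine ⟨f.GNS, inferInstance, inferInstance, inferInstance, ⟨_, _, hne⟩, f.gnsStarAlgHom,
    (f.toPreGNS 1 : f.PreGNS), ?_, hinner⟩
  rw [injective_iff_map_eq_zero]
  intro d hd
  have h1 := happ d
  rw [hd] at h1
  apply hD.eq_zero_of_trace hσ
  have h2 : ((f.toPreGNS d : f.PreGNS) : f.GNS) = 0 := h1.symm
  have h3 : ‖f.toPreGNS d‖ = 0 := by
    rw [← UniformSpace.Completion.norm_coe, h2, norm_zero]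
  have h4 := f.preGNS_norm_sq (f.toPreGNS d)
  rw [h3] at h4
  simpa [hf] using h4.symm

end Trace

/-! ### Functionals on spaces of continuous functions -/

section ContinuousFunctions

variable {X : Type*} [TopologicalSpace X]

/-- A real continuous function as a complex one. -/
def complexify : C(X, ℝ) →ₗ[ℝ] C(X, ℂ) where
  toFun f := ⟨fun x => (f x : ℂ), Complex.continuous_ofReal.comp f.continuous⟩
  map_add' f g := by ext; simp
  map_smul' c f := by ext; simp

@[simp]
theorem complexify_apply (f : C(X, ℝ)) (x : X) : complexify f x = (f x : ℂ) := rfl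

theorem exists_complexify_eq_star_mul_self {f : C(X, ℝ)} (hf : 0 ≤ f) :
    ∃ g : C(X, ℂ), complexify f = star g * g := by
  refine ⟨complexify ⟨fun x => √(f x), Real.continuous_sqrt.comp f.continuous⟩, ?_⟩
  ext x
  have : (f x : ℂ) = ((√(f x) * √(f x) : ℝ) : ℂ) := by rw [Real.mul_self_sqrt (show 0 ≤ f x from hf x)]
  simp [this]

theorem exists_eq_complexify_add (f : C(X, ℂ)) :
    ∃ g k : C(X, ℝ), f = complexify g + Complex.I • complexify k := by
  refine ⟨⟨fun x => (f x).re, by fun_prop⟩, ⟨fun x => (f x).im, by fun_prop⟩, ?_⟩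
  ext x
  simp [mul_comm Complex.I, Complex.re_add_im]

variable [CompactSpace X]

theorem exists_probabilityMeasure_integral [T2Space X] [MeasurableSpace X] [BorelSpace X]
    (φ : C(X, ℂ) →ₗ[ℂ] ℂ) (hpos : ∀ f, 0 ≤ φ (star f * f)) (h1 : φ 1 = 1) :
    ∃ μ : ProbabilityMeasure X, ∀ f, φ f = ∫ x, f x ∂(μ : Measure X) := by
  have hnonneg : ∀ f : C(X, ℝ), 0 ≤ f → 0 ≤ φ (complexify f) := fun f hf => by
    obtain ⟨g, hg⟩ := exists_complexify_eq_star_mul_self hf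
    rw [hg]; exact hpos g
  -- Adding the constant `‖f‖` makes `f` nonnegative, so `φ` is real at `f + ‖f‖` and therefore at
  -- `f`.
  have hreal : ∀ f : C(X, ℝ), ((φ (complexify f)).re : ℂ) = φ (complexify f) := fun f => by
    have h0 : 0 ≤ f + ‖f‖ • (1 : C(X, ℝ)) := fun x => by
      have := neg_le_of_abs_le (f.norm_coe_le_norm x)
      simpa using by linarith
    have h2 : complexify (f + ‖f‖ • (1 : C(X, ℝ))) = complexify f + (‖f‖ : ℂ) • 1 := by
      ext; simp
    have h3 := hnonneg _ h0
    rw [h2, map_add, map_smul, h1, Complex.le_def] at h3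
    apply Complex.ext <;> simp at h3 ⊢
    exact h3.2
  let L : CompactlySupportedContinuousMap X ℝ →ₗ[ℝ] ℝ :=
    { toFun := fun f => (φ (complexify f.toContinuousMap)).re
      map_add' := fun f g => by
        rw [← Complex.add_re, ← map_add, ← map_add]; rfl
      map_smul' := fun c f => by
        have : complexify (c • f).toContinuousMap = (c : ℂ) • complexify f.toContinuousMap := by
          ext; simp
        rw [this, map_smul]; simp }
  let Λ : CompactlySupportedContinuousMap X ℝ →ₚ[ℝ] ℝ :=
    PositiveLinearMap.mk₀ L fun f hf => (Complex.le_def.1 (hnonneg f.toContinuousMap hf)).1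
  have hint : ∀ f : C(X, ℝ), ∫ x, f x ∂(RealRMK.rieszMeasure Λ) = (φ (complexify f)).re := fun f =>
    RealRMK.integral_rieszMeasure Λ (CompactlySupportedContinuousMap.continuousMapEquiv f)
  have hprob : IsProbabilityMeasure (RealRMK.rieszMeasure Λ) := by
    have h2 := hint 1
    have h3 : complexify (1 : C(X, ℝ)) = 1 := by ext; simp
    rw [h3, h1] at h2
    simp only [ContinuousMap.one_apply, integral_const, smul_eq_mul, mul_one, Complex.one_re,
      measureReal_def] at h2
    exact ⟨(ENNReal.toReal_eq_one_iff _).1 h2⟩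
  refine ⟨⟨RealRMK.rieszMeasure Λ, hprob⟩, fun f => ?_⟩
  have hcplx : ∀ f : C(X, ℝ), φ (complexify f) = ∫ x, (f x : ℂ) ∂(RealRMK.rieszMeasure Λ) :=
    fun f => by rw [integral_complex_ofReal, hint, hreal]
  have hi : ∀ f : C(X, ℂ), Integrable f (RealRMK.rieszMeasure Λ) := fun f =>
    f.continuous.integrable_of_hasCompactSupport (HasCompactSupport.of_compactSpace f)
  obtain ⟨g, k, rfl⟩ := exists_eq_complexify_add f
  rw [map_add, map_smul, hcplx, hcplx]
  simp only [ContinuousMap.add_apply]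
  rw [ProbabilityMeasure.coe_mk, integral_add (hi _) (hi _)]
  simp only [ContinuousMap.smul_apply]
  rw [integral_smul]
  rfl

/-- Continuous linear functionals on `C(X, D)` are determined by their values at the functions
`x ↦ f(x) d`. -/
theorem ContinuousMap.clm_ext_smul_const [T2Space X] {D F : Type*} [NormedAddCommGroup D]
    [NormedSpace ℂ D] [AddCommGroup F] [Module ℂ F] [TopologicalSpace F] [T2Space F]
    {S T : C(X, D) →L[ℂ] F}
    (hST : ∀ (f : C(X, ℝ)) (d : D), 0 ≤ f →
      S (complexify f • ContinuousMap.const X d) = T (complexify f • ContinuousMap.const X d)) :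
    S = T := by
  ext a
  have hclosed : IsClosed {b | S b = T b} := isClosed_eq S.continuous T.continuous
  suffices a ∈ closure {b | S b = T b} by rwa [hclosed.closure_eq] at this
  rw [Metric.mem_closure_iff]
  intro ε hε
  -- A partition of unity subordinate to finitely many sets on which `a` is nearly constant
  -- approximates `a` uniformly by sums of functions `f d` with `f ≥ 0`.
  let U : X → Set X := fun x => {y | ‖a y - a x‖ < ε / 2}
  have hU : ∀ x, IsOpen (U x) := fun x => isOpen_lt (by fun_prop) continuous_const
  obtain ⟨t, ht⟩ := isCompact_univ.elim_finite_subcover U hU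
    fun x _ => mem_iUnion.2 ⟨x, by simp [U, hε]⟩
  obtain ⟨p, hp⟩ := PartitionOfUnity.exists_isSubordinate isClosed_univ (fun i : t => U i)
    (fun i => hU i) (by simpa [iUnion_subtype] using ht)
  refine ⟨∑ i : t, complexify (p i) • ContinuousMap.const X (a i), ?_, ?_⟩
  · simp only [mem_ofPred_eq, map_sum]
    exact Finset.sum_congr rfl fun i _ => hST _ _ fun x => p.nonneg i x
  · rw [dist_eq_norm]
    refine lt_of_le_of_lt ((ContinuousMap.norm_le _ (half_pos hε).le).2 fun y => ?_)
      (half_lt_self hε)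
    have hsum : ∑ i : t, p i y = 1 := by
      rw [← finsum_eq_sum_of_fintype]; exact p.sum_eq_one (mem_univ y)
    have hterm : ∀ i : t, ‖(p i y : ℂ) • (a y - a i)‖ ≤ p i y * (ε / 2) := fun i => by
      rw [norm_smul, Complex.norm_of_nonneg (p.nonneg i y)]
      by_cases hy : p i y = 0
      · simp [hy]
      · have : y ∈ U i := hp i (subset_tsupport _ hy)
        exact mul_le_mul_of_nonneg_left (le_of_lt this) (p.nonneg i y)
    have hdiff : (a - ∑ i : t, complexify (p i) • ContinuousMap.const X (a i)) y =
        ∑ i : t, (p i y : ℂ) • (a y - a i) := by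
      simp only [smul_sub, Finset.sum_sub_distrib, ← Finset.sum_smul]
      rw [← Complex.ofReal_sum, hsum]
      simp [ContinuousMap.sum_apply]
    rw [hdiff]
    calc _ ≤ ∑ i : t, p i y * (ε / 2) := norm_sum_le_of_le _ fun i _ => hterm i
      _ = ε / 2 := by rw [← Finset.sum_mul, hsum, one_mul]

/-- A proper ideal lies in a maximal one, and the functions in a maximal ideal vanish at a common
point. -/
theorem ContinuousMap.ideal_eq_top_of_forall_exists_ne_zero [T2Space X] (J : Ideal C(X, ℂ))
    (hJ : ∀ x, ∃ f ∈ J, f x ≠ 0) : J = ⊤ := by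
  by_contra hne
  obtain ⟨M, hM, hle⟩ := J.exists_le_maximal hne
  obtain ⟨x, hx⟩ := ContinuousMap.setOfIdeal_eq_compl_singleton (𝕜 := ℂ) M
  obtain ⟨f, hf, hfx⟩ := hJ x
  have : x ∈ ContinuousMap.setOfIdeal M := ContinuousMap.mem_setOfIdeal.2 ⟨f, hle hf, hfx⟩
  rw [hx] at this
  exact this rfl

end ContinuousFunctions

theorem eq_of_forall_integral_complex_eq {X : Type*} [TopologicalSpace X]
    [HasOuterApproxClosed X] [MeasurableSpace X] [BorelSpace X] {μ ν : Measure X} [IsFiniteMeasure μ] [IsFiniteMeasure ν]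
    (hμν : ∀ f : C(X, ℂ), ∫ x, f x ∂μ = ∫ x, f x ∂ν) : μ = ν := by
  refine ext_of_forall_integral_eq_of_IsFiniteMeasure fun f => ?_
  have := hμν (complexify f.toContinuousMap)
  simp only [complexify_apply] at this
  rw [integral_complex_ofReal, integral_complex_ofReal] at this
  exact_mod_cast this

/-! ### Minimal homeomorphisms -/

/-- The orbit of a periodic point would be a finite, hence closed, nonempty invariant set, so it
would be all of the infinite space `X`. -/
theorem IsMinimalHomeomorph.zpow_apply_ne {X : Type*} [TopologicalSpace X] [T1Space X] [Infinite X]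
    {h : X ≃ₜ X} (hmin : IsMinimalHomeomorph h) {n : ℤ} (hn : n ≠ 0) (x : X) :
    (h ^ n) x ≠ x := by
  intro hx
  have hmul : ∀ k : ℤ, (h ^ (n * k)) x = x := by
    have hinv : (h ^ n)⁻¹ x = x := (h ^ n).toEquiv.symm_apply_eq.2 hx.symm
    intro k
    rw [zpow_mul]
    induction k using Int.induction_on with
    | zero => rfl
    | succ k ih => rw [zpow_add_one]; exact (congrArg ((h ^ n) ^ (k : ℤ)) hx).trans ih
    | pred k ih => rw [zpow_sub_one]; exact (congrArg ((h ^ n) ^ (-k : ℤ)) hinv).trans ih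
  have hfin : (range fun k : ℤ => (h ^ k) x).Finite := by
    refine ((finite_Ico (0 : ℤ) |n|).image fun k => (h ^ k) x).subset ?_
    rintro _ ⟨k, rfl⟩
    refine ⟨k % n, ⟨Int.emod_nonneg k hn, Int.emod_lt_abs k hn⟩, ?_⟩
    conv_rhs => rw [← Int.emod_add_mul_ediv k n]
    simp only [zpow_add]
    exact congrArg (h ^ (k % n)) (hmul (k / n)).symm
  have himg : h '' (range fun k : ℤ => (h ^ k) x) = range fun k : ℤ => (h ^ k) x := by
    have hstep : ∀ k : ℤ, h ((h ^ k) x) = (h ^ (k + 1)) x := fun k => by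
      rw [add_comm, zpow_add, zpow_one]; rfl
    ext y
    constructor
    · rintro ⟨_, ⟨k, rfl⟩, rfl⟩
      exact ⟨k + 1, (hstep k).symm⟩
    · rintro ⟨k, rfl⟩
      exact ⟨_, ⟨k - 1, rfl⟩, by simp [hstep]⟩
  rcases hmin _ hfin.isClosed himg with h0 | h1
  · exact (range_nonempty _).ne_empty h0
  · rw [h1] at hfin
    exact infinite_univ hfin

/-! ### Traces on the crossed product -/

namespace CrossedProduct

universe u

variable {A : Type u} [CStarAlgebra A] {α : A ≃⋆ₐ[ℂ] A}

theorem map_zpow_of_map {φ : A → ℂ} (hφ : ∀ a, φ (α a) = φ a) (n : ℤ) (a : A) :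
    φ ((α ^ n) a) = φ a := by
  induction n using Int.induction_on generalizing a with
  | zero => simp
  | succ n ih => rw [zpow_add_one, StarAlgEquiv.mul_apply, ih, hφ]
  | pred n ih =>
    rw [zpow_sub_one, StarAlgEquiv.mul_apply, ih, ← hφ]
    exact congrArg φ (α.apply_symm_apply a)

theorem IsStandardExpectation.trace_mul_comm {E : CrossedProduct α →L[ℂ] A}
    (hE : IsStandardExpectation α E) (φ : A →L[ℂ] ℂ) (htr : ∀ a b, φ (a * b) = φ (b * a))
    (hinv : ∀ a, φ (α a) = φ a) (x y : CrossedProduct α) : φ (E (x * y)) = φ (E (y * x)) := by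
  have hmono : ∀ m a n b, φ (E (monomial α m a * monomial α n b)) =
      φ (E (monomial α n b * monomial α m a)) := by
    intro m a n b
    rw [monomial_mul_monomial, monomial_mul_monomial, hE.apply_monomial, hE.apply_monomial,
      add_comm n m]
    split_ifs with hmn
    -- Applying the invariance of `φ` under `α ^ m` turns `b * (α ^ (-m)) a` into `(α ^ m) b * a`.
    · obtain rfl : n = -m := by omega
      rw [← map_zpow_of_map hinv m (b * (α ^ (-m)) a), map_mul (α ^ m), ← StarAlgEquiv.mul_apply,
        ← zpow_add, add_neg_cancel, zpow_zero, StarAlgEquiv.one_apply, htr]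
    · rfl
  let τ : CrossedProduct α →L[ℂ] ℂ := φ.comp E
  have hleft : ∀ m a y, τ (monomial α m a * y) = τ (y * monomial α m a) := by
    intro m a y
    have : τ.comp (ContinuousLinearMap.mul ℂ _ (monomial α m a)) =
        τ.comp ((ContinuousLinearMap.mul ℂ _).flip (monomial α m a)) :=
      clm_ext fun n b => hmono m a n b
    exact DFunLike.congr_fun this y
  have : τ.comp ((ContinuousLinearMap.mul ℂ _).flip y) =
      τ.comp (ContinuousLinearMap.mul ℂ _ y) := clm_ext fun n b => hleft n b y
  exact DFunLike.congr_fun this x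

theorem trace_ι_apply {τ : CrossedProduct α → ℂ} (hτ : ∀ x y, τ (x * y) = τ (y * x)) (a : A) :
    τ (ι α (α a)) = τ (ι α a) := by
  rw [← u_mul_ι_mul_star_u, hτ, ← mul_assoc, Unitary.coe_star_mul_self, one_mul]

/-- Cycling `b` around the trace and moving it back past `uⁿ` twists it by `α ^ n`. -/
theorem trace_monomial_mul {τ : CrossedProduct α → ℂ} (hτ : ∀ x y, τ (x * y) = τ (y * x)) (n : ℤ)
    (a b : A) : τ (monomial α n (b * a)) = τ (monomial α n (a * (α ^ n) b)) := by
  have h := hτ (monomial α n a) (monomial α 0 b)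
  rw [monomial_mul_monomial, monomial_mul_monomial, zpow_zero, StarAlgEquiv.one_apply, add_zero,
    zero_add] at h
  exact h.symm

end CrossedProduct

/-! ### The automorphism over a homeomorphism -/

section AutomorphismOver

variable {X D : Type*} [TopologicalSpace X] [CStarAlgebra D]
  (h : X ≃ₜ X) (β : X → D ≃⋆ₐ[ℂ] D) (hβ : ∀ d, Continuous fun x => β x d)

theorem automorphismOver_apply (a : C(X, D)) (x : X) :
    automorphismOver h β hβ a x = β x (a (h.symm x)) := rfl

theorem automorphismOver_smul_one (f : C(X, ℂ)) :
    automorphismOver h β hβ (f • 1) = f.comp (h.symm : C(X, X)) • 1 := by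
  ext x
  simp [automorphismOver_apply]

theorem automorphismOver_zpow_smul_one (n : ℤ) (f : C(X, ℂ)) :
    (automorphismOver h β hβ ^ n) (f • 1) = f.comp ((h ^ (-n) : X ≃ₜ X) : C(X, X)) • 1 := by
  induction n using Int.induction_on generalizing f with
  | zero => rfl
  | succ n ih =>
    rw [zpow_add_one, StarAlgEquiv.mul_apply, automorphismOver_smul_one, ih, neg_add, add_comm,
      zpow_add, zpow_neg_one]
    rfl
  | pred n ih =>
    have h1 : (automorphismOver h β hβ)⁻¹ (f • 1) = f.comp (h : C(X, X)) • 1 := by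
      apply EquivLike.injective (automorphismOver h β hβ)
      rw [automorphismOver_smul_one]
      refine ((automorphismOver h β hβ).apply_symm_apply _).trans ?_
      ext x
      simp
    rw [zpow_sub_one, StarAlgEquiv.mul_apply, h1, ih, neg_sub, sub_neg_eq_add, neg_neg,
      zpow_add, zpow_one]
    rfl

end AutomorphismOver

/-! ### Traces from invariant measures -/

section UniqueTrace

variable {D : Type*} [CStarAlgebra D] {σ : WeakDual ℂ D}

theorem eq_smul_of_tracialStates_eq (hσ : tracialStates D = {σ}) (φ : D →L[ℂ] ℂ)
    (hpos : ∀ d, 0 ≤ φ (star d * d)) (htr : ∀ a b, φ (a * b) = φ (b * a)) (h1 : φ 1 ≠ 0) (d : D) :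
    φ d = φ 1 * σ d := by
  have h0 : 0 ≤ φ 1 := by simpa using hpos 1
  have hmem : StrongDual.toWeakDual ((φ 1)⁻¹ • φ) ∈ tracialStates D := by
    refine ⟨fun a => ?_, ?_, fun a b => ?_⟩
    · exact mul_nonneg (inv_nonneg.2 h0) (hpos a)
    · exact inv_mul_cancel₀ h1
    · exact congrArg ((φ 1)⁻¹ * ·) (htr a b)
  rw [hσ, mem_singleton_iff] at hmem
  have := DFunLike.congr_fun hmem d
  rw [← this]
  exact (mul_inv_cancel_left₀ h1 (φ d)).symm

theorem mem_tracialStates_of_eq (hσ : tracialStates D = {σ}) : σ ∈ tracialStates D := by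
  rw [hσ]; rfl

/-- The composition of `σ` with an automorphism is again a tracial state. This is why the fibre
automorphisms `β x` leave no trace in the integral. -/
theorem uniqueTrace_apply_starAlgEquiv (hσ : tracialStates D = {σ}) (γ : D ≃⋆ₐ[ℂ] D) (d : D) :
    σ (γ d) = σ d := by
  have hs := mem_tracialStates_of_eq hσ
  let φ : D →L[ℂ] ℂ := ⟨(σ : D →ₗ[ℂ] ℂ) ∘ₗ (γ : D →⋆ₐ[ℂ] D).toAlgHom.toLinearMap,
    σ.continuous.comp (StarAlgEquiv.isometry γ).continuous⟩
  have hφ : ∀ d, φ d = σ (γ d) := fun _ => rfl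
  have h1 : φ 1 = 1 := by rw [hφ, map_one, hs.2.1]
  have := eq_smul_of_tracialStates_eq hσ φ
    (fun d => by rw [hφ, map_mul, map_star]; exact hs.1 _)
    (fun a b => by rw [hφ, hφ, map_mul γ, map_mul γ, hs.2.2]) (by rw [h1]; exact one_ne_zero) d
  rwa [h1, one_mul] at this

variable {X : Type*} [TopologicalSpace X] [CompactSpace X] [MeasurableSpace X] [BorelSpace X]

theorem integrable_functional_comp (σ : WeakDual ℂ D) (μ : ProbabilityMeasure X) (a : C(X, D)) :
    Integrable (fun x => σ (a x)) (μ : Measure X) :=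
  (σ.continuous.comp a.continuous).integrable_of_hasCompactSupport
    (HasCompactSupport.of_compactSpace _)

/-- The functional `a ↦ ∫ σ(a(x)) dμ(x)` on `C(X, D)`. -/
noncomputable def integralFunctional (σ : WeakDual ℂ D) (μ : ProbabilityMeasure X) :
    C(X, D) →L[ℂ] ℂ :=
  LinearMap.mkContinuous
    { toFun := fun a => ∫ x, σ (a x) ∂(μ : Measure X)
      map_add' := fun a b => by
        simp only [ContinuousMap.add_apply, map_add]
        exact integral_add (integrable_functional_comp σ μ a) (integrable_functional_comp σ μ b)
      map_smul' := fun c a => by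
        simp only [ContinuousMap.smul_apply, map_smul, RingHom.id_apply]
        exact integral_smul c _ }
    ‖WeakDual.toStrongDual σ‖ fun a => by
      have : ∀ x, ‖σ (a x)‖ ≤ ‖WeakDual.toStrongDual σ‖ * ‖a‖ := fun x =>
        ((WeakDual.toStrongDual σ).le_opNorm (a x)).trans
          (mul_le_mul_of_nonneg_left (a.norm_coe_le_norm x) (norm_nonneg _))
      simpa using norm_integral_le_of_norm_le_const (μ := (μ : Measure X)) (.of_forall this)

theorem integralFunctional_apply (σ : WeakDual ℂ D) (μ : ProbabilityMeasure X) (a : C(X, D)) :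
    integralFunctional σ μ a = ∫ x, σ (a x) ∂(μ : Measure X) := rfl

theorem integralFunctional_smul_const (σ : WeakDual ℂ D) (μ : ProbabilityMeasure X)
    (f : C(X, ℂ)) (d : D) :
    integralFunctional σ μ (f • ContinuousMap.const X d) =
      (∫ x, f x ∂(μ : Measure X)) * σ d := by
  rw [integralFunctional_apply, ← integral_mul_const]
  simp

theorem integralFunctional_smul_one (hσ : tracialStates D = {σ}) (μ : ProbabilityMeasure X)
    (f : C(X, ℂ)) :
    integralFunctional σ μ (f • (1 : C(X, D))) = ∫ x, f x ∂(μ : Measure X) := by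
  refine (integralFunctional_smul_const σ μ f 1).trans ?_
  rw [(mem_tracialStates_of_eq hσ).2.1, mul_one]

theorem integralFunctional_mul_comm (hσ : tracialStates D = {σ}) (μ : ProbabilityMeasure X)
    (a b : C(X, D)) : integralFunctional σ μ (a * b) = integralFunctional σ μ (b * a) := by
  simp only [integralFunctional_apply, ContinuousMap.mul_apply,
    (mem_tracialStates_of_eq hσ).2.2 (a _)]

theorem integralFunctional_automorphismOver (hσ : tracialStates D = {σ}) {h : X ≃ₜ X}
    (β : X → D ≃⋆ₐ[ℂ] D) (hβ : ∀ d, Continuous fun x => β x d) {μ : ProbabilityMeasure X}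
    (hμ : μ ∈ invariantMeasures h) (a : C(X, D)) :
    integralFunctional σ μ (automorphismOver h β hβ a) = integralFunctional σ μ a := by
  simp only [integralFunctional_apply, automorphismOver_apply, uniqueTrace_apply_starAlgEquiv hσ]
  have hμ' : (μ : Measure X).map h = μ := hμ
  conv_lhs => rw [← hμ']
  rw [h.measurableEmbedding.integral_map]
  simp

end UniqueTrace

/-! ### The tracial states of the crossed product -/

section Main

universe u v

variable {X : Type u} {D : Type v} [CStarAlgebra D] {σ : WeakDual ℂ D}

section Topological

variable [TopologicalSpace X] [CompactSpace X]

/-- Evaluation at a point, as a *-homomorphism. -/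
def ContinuousMap.evalStarHom (x : X) : C(X, D) →⋆ₐ[ℂ] D where
  toFun a := a x
  map_one' := rfl
  map_mul' _ _ := rfl
  map_zero' := rfl
  map_add' _ _ := rfl
  commutes' _ := rfl
  map_star' _ := rfl

theorem ContinuousMap.star_smul_mul_smul (f : C(X, ℂ)) (a : C(X, D)) :
    star (f • a) * (f • a) = (star f * f) • (star a * a) := by
  ext x
  simp [mul_smul, smul_comm (f x)]

/-- An injective representation of `D` is isometric, so the representations `a ↦ π (a x)`, over all
points `x`, determine the supremum norm. -/
theorem IsSimpleCStarAlgebra.exists_expectation (hD : IsSimpleCStarAlgebra D)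
    (hσ : σ ∈ tracialStates D) (α : C(X, D) ≃⋆ₐ[ℂ] C(X, D)) :
    ∃ E : CrossedProduct α →L[ℂ] C(X, D), CrossedProduct.IsStandardExpectation α E := by
  obtain ⟨H, _, _, _, _, π, ξ, hπ, -⟩ := hD.exists_faithful_rep hσ
  refine CrossedProduct.exists_isStandardExpectation.{u, v} α
    (fun x : X => π.comp (ContinuousMap.evalStarHom x)) fun a C hC hle => ?_
  refine (ContinuousMap.norm_le _ hC).2 fun x => ?_
  rw [← NonUnitalStarAlgHom.norm_map π hπ]
  exact hle x

theorem IsSimpleCStarAlgebra.apply_expectation_nonneg (hD : IsSimpleCStarAlgebra D)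
    (hσ : σ ∈ tracialStates D) {α : C(X, D) ≃⋆ₐ[ℂ] C(X, D)}
    {E : CrossedProduct α →L[ℂ] C(X, D)} (hE : CrossedProduct.IsStandardExpectation α E)
    (a : CrossedProduct α) (x : X) : 0 ≤ σ (E (star a * a) x) := by
  obtain ⟨H, _, _, _, _, π, ξ, -, hξ⟩ := hD.exists_faithful_rep hσ
  rw [← hξ]
  exact hE.inner_nonneg.{u, v} α (π.comp (ContinuousMap.evalStarHom x)) ξ a

variable [MeasurableSpace X] [BorelSpace X]

/-- The functional `τ_μ` on the crossed product. -/
noncomputable def measureTrace (σ : WeakDual ℂ D) {α : C(X, D) ≃⋆ₐ[ℂ] C(X, D)}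
    (E : CrossedProduct α →L[ℂ] C(X, D)) (μ : ProbabilityMeasure X) :
    WeakDual ℂ (CrossedProduct α) :=
  StrongDual.toWeakDual ((integralFunctional σ μ).comp E)

theorem measureTrace_apply (σ : WeakDual ℂ D) {α : C(X, D) ≃⋆ₐ[ℂ] C(X, D)}
    (E : CrossedProduct α →L[ℂ] C(X, D)) (μ : ProbabilityMeasure X) (a : CrossedProduct α) :
    measureTrace σ E μ a = integralFunctional σ μ (E a) := rfl

theorem measureTrace_ι_smul_one (hσ : tracialStates D = {σ}) {α : C(X, D) ≃⋆ₐ[ℂ] C(X, D)}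
    {E : CrossedProduct α →L[ℂ] C(X, D)} (hE : CrossedProduct.IsStandardExpectation α E)
    (μ : ProbabilityMeasure X) (f : C(X, ℂ)) :
    measureTrace σ E μ (CrossedProduct.ι α (f • 1)) = ∫ x, f x ∂(μ : Measure X) := by
  rw [measureTrace_apply, hE.apply_ι, integralFunctional_smul_one hσ]

theorem measureTrace_mem_tracialStates (hD : IsSimpleCStarAlgebra D)
    (hσ : tracialStates D = {σ}) {h : X ≃ₜ X} {β : X → D ≃⋆ₐ[ℂ] D}
    {hβ : ∀ d, Continuous fun x => β x d}
    {E : CrossedProduct (automorphismOver h β hβ) →L[ℂ] C(X, D)}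
    (hE : CrossedProduct.IsStandardExpectation (automorphismOver h β hβ) E)
    {μ : ProbabilityMeasure X} (hμ : μ ∈ invariantMeasures h) :
    measureTrace σ E μ ∈ tracialStates (CrossedProduct (automorphismOver h β hβ)) := by
  refine ⟨fun a => ?_, ?_, fun a b => ?_⟩
  · rw [measureTrace_apply, integralFunctional_apply]
    exact integral_nonneg
      fun x => hD.apply_expectation_nonneg (mem_tracialStates_of_eq hσ) hE a x
  · have := measureTrace_ι_smul_one hσ hE μ 1
    rw [one_smul, map_one] at this
    simpa using this
  · exact hE.trace_mul_comm _ (integralFunctional_mul_comm hσ μ)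
      (integralFunctional_automorphismOver hσ β hβ hμ) a b

end Topological

/-! ### Every tracial state comes from an invariant measure -/

variable [MetricSpace X] [CompactSpace X]

/-- A scalar function `f` can be cycled around the trace, which turns it into `f ∘ h⁻ⁿ`; so `τ`
kills `(f - f ∘ h⁻ⁿ) a uⁿ`. The functions with this annihilating property form an ideal, and it has
no common zero. -/
theorem trace_monomial_eq_zero [Infinite X] {h : X ≃ₜ X} (hmin : IsMinimalHomeomorph h)
    {β : X → D ≃⋆ₐ[ℂ] D} {hβ : ∀ d, Continuous fun x => β x d}
    {τ : WeakDual ℂ (CrossedProduct (automorphismOver h β hβ))}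
    (hτ : τ ∈ tracialStates (CrossedProduct (automorphismOver h β hβ))) {n : ℤ} (hn : n ≠ 0)
    (a : C(X, D)) : τ (CrossedProduct.monomial (automorphismOver h β hβ) n a) = 0 := by
  let J : Ideal C(X, ℂ) :=
    { carrier := {f | ∀ a, τ (CrossedProduct.monomial (automorphismOver h β hβ) n (f • a)) = 0}
      add_mem' := fun {f g} hf hg a => by rw [add_smul, map_add, map_add, hf a, hg a, add_zero]
      zero_mem' := fun a => by rw [zero_smul, map_zero, map_zero]
      smul_mem' := fun g f hf a => by rw [smul_eq_mul, mul_comm, mul_smul]; exact hf _ }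
  have hJ : J = ⊤ := by
    refine ContinuousMap.ideal_eq_top_of_forall_exists_ne_zero J fun x => ?_
    -- The distance to `x` vanishes only at `x`, so `f` takes different values at `x` and at `h⁻ⁿ x
    -- ≠ x`.
    let f : C(X, ℂ) := complexify ⟨fun y => dist y x, by fun_prop⟩
    refine ⟨f - f.comp ((h ^ (-n) : X ≃ₜ X) : C(X, X)), fun b => ?_, ?_⟩
    · have h1 := CrossedProduct.trace_monomial_mul hτ.2.2 n b (f • 1)
      rw [automorphismOver_zpow_smul_one] at h1
      have h2 : (f • (1 : C(X, D))) * b = f • b := by ext; simp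
      have h3 : b * (f.comp ((h ^ (-n) : X ≃ₜ X) : C(X, X)) • (1 : C(X, D))) =
        f.comp ((h ^ (-n) : X ≃ₜ X) : C(X, X)) • b := by ext; simp
      rw [h2, h3] at h1
      rw [sub_smul, map_sub, map_sub, h1, sub_self]
    · have := hmin.zpow_apply_ne (neg_ne_zero.2 hn) x
      simpa [f] using this
  have h1 : (1 : C(X, ℂ)) ∈ J := by rw [hJ]; trivial
  simpa using h1 a

theorem trace_ι_smul_const (hσ : tracialStates D = {σ}) {α : C(X, D) ≃⋆ₐ[ℂ] C(X, D)}
    {τ : WeakDual ℂ (CrossedProduct α)} (hτ : τ ∈ tracialStates (CrossedProduct α))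
    {f : C(X, ℝ)} (hf : 0 ≤ f) (d : D) :
    τ (CrossedProduct.ι α (complexify f • ContinuousMap.const X d)) =
      τ (CrossedProduct.ι α (complexify f • 1)) * σ d := by
  have key : ∀ f : C(X, ℝ), 0 ≤ f → τ (CrossedProduct.ι α (complexify f • 1)) ≠ 0 → ∀ d : D,
      τ (CrossedProduct.ι α (complexify f • ContinuousMap.const X d)) =
      τ (CrossedProduct.ι α (complexify f • 1)) * σ d := by
    intro f hf hne
    let φ : D →L[ℂ] ℂ :=
      { toFun := fun d => τ (CrossedProduct.ι α (complexify f • ContinuousMap.const X d))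
        map_add' := fun d e => by
          rw [← map_add, ← map_add, ← smul_add]; rfl
        map_smul' := fun c d => by
          have : complexify f • ContinuousMap.const X (c • d) =
              c • complexify f • ContinuousMap.const X d := by
            ext x
            simp [smul_comm c]
          rw [RingHom.id_apply, ← map_smul, ← map_smul, this]
        cont := by
          refine τ.continuous.comp ((CrossedProduct.ι α).continuous_of_cstarAlgebra.comp ?_)
          have : ∀ d, complexify f • ContinuousMap.const X d =
              (complexify f • (1 : C(X, D))) * ContinuousMap.const X d := fun d => by ext; simp
          simp only [this]
          exact continuous_const.mul ContinuousMap.continuous_const' }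
    obtain ⟨g, hg⟩ := exists_complexify_eq_star_mul_self hf
    refine eq_smul_of_tracialStates_eq hσ φ (fun d => ?_) (fun a b => ?_) hne
    · have : complexify f • ContinuousMap.const X (star d * d) =
          star (g • ContinuousMap.const X d) * (g • ContinuousMap.const X d) := by
        rw [ContinuousMap.star_smul_mul_smul, ← hg]; rfl
      change 0 ≤ τ (CrossedProduct.ι α _)
      rw [this, map_mul, map_star]
      exact hτ.1 _
    · have : ∀ a b : D, complexify f • ContinuousMap.const X (a * b) =
          (complexify f • ContinuousMap.const X a) * ContinuousMap.const X b := fun a b => by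
        ext x
        simp
      have h' : complexify f • ContinuousMap.const X (b * a) =
          ContinuousMap.const X b * (complexify f • ContinuousMap.const X a) := by
        ext x
        simp
      change τ (CrossedProduct.ι α _) = τ (CrossedProduct.ι α _)
      rw [this, h', map_mul (CrossedProduct.ι α), map_mul (CrossedProduct.ι α), hτ.2.2]
  have hpos : 0 ≤ τ (CrossedProduct.ι α (complexify f • 1)) := by
    obtain ⟨g, hg⟩ := exists_complexify_eq_star_mul_self hf
    have : complexify f • (1 : C(X, D)) = star (g • 1) * (g • 1) := by
      rw [ContinuousMap.star_smul_mul_smul, ← hg, star_one, one_mul]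
    rw [this, map_mul, map_star]
    exact hτ.1 _
  have h1 : complexify (1 : C(X, ℝ)) = 1 := by ext; simp
  have hone : τ (CrossedProduct.ι α (complexify (1 : C(X, ℝ)) • 1)) = 1 := by
    rw [h1, one_smul, map_one, hτ.2.1]
  -- Normalising requires `τ(f) ≠ 0`. Since `τ(f + 1) ≥ 1`, the identity holds for `1` and for `f +
  -- 1`, and subtraction gives it for `f`.
  have e1 := key 1 zero_le_one (by rw [hone]; exact one_ne_zero) d
  have e2 := key (f + 1) (add_nonneg hf zero_le_one) (by
    rw [map_add, add_smul, map_add, map_add, hone]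
    exact (add_pos_of_nonneg_of_pos hpos one_pos).ne') d
  simp only [map_add, add_smul] at e2
  rw [e1, add_mul] at e2
  exact add_right_cancel e2

variable [MeasurableSpace X] [BorelSpace X]

theorem exists_measureTrace_eq [Infinite X] (hσ : tracialStates D = {σ}) {h : X ≃ₜ X}
    (hmin : IsMinimalHomeomorph h) {β : X → D ≃⋆ₐ[ℂ] D} {hβ : ∀ d, Continuous fun x => β x d}
    {E : CrossedProduct (automorphismOver h β hβ) →L[ℂ] C(X, D)}
    (hE : CrossedProduct.IsStandardExpectation (automorphismOver h β hβ) E)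
    {τ : WeakDual ℂ (CrossedProduct (automorphismOver h β hβ))}
    (hτ : τ ∈ tracialStates (CrossedProduct (automorphismOver h β hβ))) :
    ∃ μ ∈ invariantMeasures h, measureTrace σ E μ = τ := by
  let α := automorphismOver h β hβ
  let φ : C(X, ℂ) →ₗ[ℂ] ℂ :=
    { toFun := fun f => τ (CrossedProduct.ι α (f • 1))
      map_add' := fun f g => by rw [add_smul, map_add, map_add]
      map_smul' := fun c f => by
        have : (c • f) • (1 : C(X, D)) = c • f • 1 := by ext; simp [mul_smul]
        rw [this, map_smul, map_smul, RingHom.id_apply] }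
  obtain ⟨μ, hμ⟩ := exists_probabilityMeasure_integral φ
    (fun f => by
      change 0 ≤ τ (CrossedProduct.ι α _)
      have : (star f * f) • (1 : C(X, D)) = star (f • 1) * (f • 1) := by
        rw [ContinuousMap.star_smul_mul_smul, star_one, one_mul]
      rw [this, map_mul, map_star]
      exact hτ.1 _)
    (by
      change τ (CrossedProduct.ι α _) = 1
      rw [one_smul, map_one, hτ.2.1])
  have hμ' : ∀ f : C(X, ℂ), τ (CrossedProduct.ι α (f • 1)) = ∫ x, f x ∂(μ : Measure X) := hμ
  refine ⟨μ, ?_, ?_⟩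
  -- Invariance of `μ` comes from `τ ∘ α = τ` on scalar functions.
  · have : IsProbabilityMeasure ((μ : Measure X).map h) :=
      Measure.isProbabilityMeasure_map h.continuous.measurable.aemeasurable
    refine eq_of_forall_integral_complex_eq fun f => ?_
    rw [h.measurableEmbedding.integral_map]
    have h1 := CrossedProduct.trace_ι_apply (α := α) hτ.2.2 (f.comp (h : C(X, X)) • 1)
    rw [automorphismOver_smul_one, hμ', hμ'] at h1
    simpa using h1.symm
  · have hA : (integralFunctional σ μ) =
        (⟨(τ : _ →ₗ[ℂ] ℂ) ∘ₗ (CrossedProduct.ι α).toAlgHom.toLinearMap,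
          τ.continuous.comp (CrossedProduct.ι α).continuous_of_cstarAlgebra⟩ : C(X, D) →L[ℂ] ℂ) :=
      ContinuousMap.clm_ext_smul_const fun f d hf => by
        refine (integralFunctional_smul_const σ μ _ d).trans ?_
        rw [← hμ']
        exact (trace_ι_smul_const hσ hτ hf d).symm
    refine WeakDual.toStrongDual.injective (CrossedProduct.clm_ext fun n a => ?_)
    change integralFunctional σ μ (E _) = τ _
    rw [hE.apply_monomial]
    split_ifs with hn
    · rw [hn, CrossedProduct.monomial_zero, hA]
      rfl
    · rw [map_zero, trace_monomial_eq_zero hmin hτ hn]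

/-! ### Injectivity and comparison of the topologies -/

theorem measureTrace_injective (hσ : tracialStates D = {σ}) {α : C(X, D) ≃⋆ₐ[ℂ] C(X, D)}
    {E : CrossedProduct α →L[ℂ] C(X, D)} (hE : CrossedProduct.IsStandardExpectation α E) :
    Function.Injective (measureTrace (X := X) σ E) := fun μ ν hμν => by
  suffices hm : (μ : Measure X) = ν from Subtype.ext hm
  refine eq_of_forall_integral_complex_eq fun f => ?_
  have := DFunLike.congr_fun hμν (CrossedProduct.ι α (f • 1))
  rwa [measureTrace_ι_smul_one hσ hE, measureTrace_ι_smul_one hσ hE] at this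

theorem continuous_measureTrace (σ : WeakDual ℂ D) {α : C(X, D) ≃⋆ₐ[ℂ] C(X, D)}
    (E : CrossedProduct α →L[ℂ] C(X, D)) : Continuous (measureTrace (X := X) σ E) := by
  refine WeakDual.continuous_of_continuous_eval fun a => ?_
  rw [continuous_iff_continuousAt]
  intro μ
  exact (ProbabilityMeasure.tendsto_iff_forall_integral_rclike_tendsto ℂ).1 Filter.tendsto_id
    (BoundedContinuousFunction.mkOfCompact ⟨fun x => σ (E a x), σ.continuous.comp (E a).continuous⟩)

/-- Evaluating the trace at the scalar function `f` recovers `∫ f dμ`, so weak-* convergence of the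
traces forces weak convergence of the measures. -/
theorem isInducing_measureTrace (hσ : tracialStates D = {σ}) {α : C(X, D) ≃⋆ₐ[ℂ] C(X, D)}
    {E : CrossedProduct α →L[ℂ] C(X, D)} (hE : CrossedProduct.IsStandardExpectation α E) :
    IsInducing (measureTrace (X := X) σ E) := by
  rw [isInducing_iff_nhds]
  intro μ
  refine le_antisymm ((continuous_measureTrace σ E).tendsto μ).le_comap ?_
  suffices ht : Filter.Tendsto id (Filter.comap (measureTrace σ E) (𝓝 (measureTrace σ E μ)))
      (𝓝 μ) from ht
  rw [ProbabilityMeasure.tendsto_iff_forall_integral_rclike_tendsto ℂ]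
  intro f
  have hf : ∀ ν : ProbabilityMeasure X, ∫ x, f x ∂(ν : Measure X) =
      measureTrace σ E ν (CrossedProduct.ι α (f.toContinuousMap • 1)) := fun ν =>
    (measureTrace_ι_smul_one hσ hE ν f.toContinuousMap).symm
  simp only [id, hf]
  exact ((WeakDual.eval_continuous _).tendsto _).comp Filter.tendsto_comap

end Main

theorem mainTheorem12 {X D : Type*} [MetricSpace X] [CompactSpace X] [Infinite X]
    [MeasurableSpace X] [BorelSpace X] [CStarAlgebra D]
    (hsimple : IsSimpleCStarAlgebra D) (hexact : IsExactCStarAlgebra D)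
    (σ : WeakDual ℂ D) (hσ : tracialStates D = {σ})
    (h : X ≃ₜ X) (hmin : IsMinimalHomeomorph h)
    (β : X → D ≃⋆ₐ[ℂ] D) (hβ : ∀ d, Continuous fun x => β x d) :
    (∃! E : CrossedProduct (automorphismOver h β hβ) →L[ℂ] C(X, D),
      CrossedProduct.IsStandardExpectation (automorphismOver h β hβ) E) ∧
    ∀ E : CrossedProduct (automorphismOver h β hβ) →L[ℂ] C(X, D),
      CrossedProduct.IsStandardExpectation (automorphismOver h β hβ) E →
      ∃ T : invariantMeasures h ≃ₜ tracialStates (CrossedProduct (automorphismOver h β hβ)),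
        (∀ (μ : invariantMeasures h) (a : CrossedProduct (automorphismOver h β hβ)),
          (T μ).1 a = ∫ x, σ (E a x) ∂(μ.1 : Measure X)) ∧
        ∀ (μ ν ρ : invariantMeasures h) (s t : ℝ≥0), s + t = 1 →
          (ρ.1 : Measure X) = s • (μ.1 : Measure X) + t • (ν.1 : Measure X) →
          (T ρ).1 = ((s : ℝ) : ℂ) • (T μ).1 + ((t : ℝ) : ℂ) • (T ν).1 := by
  refine ⟨?_, fun E hE => ?_⟩
  · obtain ⟨E, hE⟩ := hsimple.exists_expectation (mem_tracialStates_of_eq hσ)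
      (automorphismOver h β hβ)
    exact ⟨E, hE, fun F hF => hF.unique hE⟩
  let T : invariantMeasures h → tracialStates (CrossedProduct (automorphismOver h β hβ)) :=
    fun μ => ⟨measureTrace σ E μ.1, measureTrace_mem_tracialStates hsimple hσ hE μ.2⟩
  have hind : IsInducing T := by
    have h1 : IsInducing fun μ : invariantMeasures h => measureTrace σ E μ.1 :=
      (isInducing_measureTrace hσ hE).comp .subtypeVal
    exact IsInducing.of_comp_iff .subtypeVal |>.1 h1
  have hbij : Function.Bijective T := by
    refine ⟨fun μ ν hμν => ?_, fun τ => ?_⟩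
    · exact Subtype.ext (measureTrace_injective hσ hE (congrArg Subtype.val hμν))
    · obtain ⟨μ, hμ, hτ⟩ := exists_measureTrace_eq hσ hmin hE τ.2
      exact ⟨⟨μ, hμ⟩, Subtype.ext hτ⟩
  refine ⟨(Equiv.ofBijective T hbij).toHomeomorphOfIsInducing hind, fun _ _ => rfl, ?_⟩
  intro μ ν ρ s t _ hρ
  refine DFunLike.ext _ _ fun a => ?_
  change ∫ x, σ (E a x) ∂(ρ.1 : Measure X) =
    (s : ℂ) * ∫ x, σ (E a x) ∂(μ.1 : Measure X) + (t : ℂ) * ∫ x, σ (E a x) ∂(ν.1 : Measure X)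
  rw [hρ, integral_add_measure
    ((integrable_functional_comp σ μ.1 (E a)).smul_measure_nnreal)
    ((integrable_functional_comp σ ν.1 (E a)).smul_measure_nnreal),
    integral_smul_nnreal_measure, integral_smul_nnreal_measure]
  rfl
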